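/- A graph function is a Borel function $g:[0,1]^2\to[0,1]$ with $g(x,y)=g(y,x)$ almost everywhere. A graphon is an equivalence class $\gamma=[g]$ of graph functions for the relation $\delta_\square(g_1,g_2)=0$, where $$\delta_\square(g_1,g_2)=\inf_\sigma\ \sup_{S,T\subset[0,1]\text{ measurable}}\left|\int_{S\times T}\big(g_1(\sigma(x),\sigma(y))-g_2(x,y)\big)\,dx\,dy\right|$$ and $\sigma$ runs over the measure-preserving measurable bijections of $[0,1]$. For a finite simple graph $F$ on $\{1,\dots,k\}$, put $t(F,\gamma)=\int_{[0,1]^k}\prod_{\{i,j\}\in E_F}g(x_i,x_j)\,dx_1\cdots dx_k$ (this does not depend on the representative $g$). The edge density of $\gamma$ is $p=\iint g(x,y)\,dx\,dy$. The graphon $\gamma$ is called singular if for all non-empty finite graphs $F_1,F_2$ with $k_1,k_2$ vertices, $$t(F_1\sqcup F_2,\gamma)=\frac1{k_1k_2}\sum_{i_1=1}^{k_1}\sum_{i_2=1}^{k_2}t\big((F_1\bowtie F_2)(i_1,i_2),\gamma\big),$$ where $(F_1\bowtie F_2)(i_1,i_2)$ is obtained from the disjoint union $F_1\sqcup F_2$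 by identifying the vertex $i_1$ of $F_1$ with the vertex $i_2$ of $F_2$. For $n\ge1$, the $W$-random graph $G_n(\gamma)$ has vertex set $\{1,\dots,n\}$ and, for $i<j$, an edge between $i$ and $j$ if and only if $U_{ij}\le g(X_i,X_j)$, where the $X_i$ and the $U_{ij}$ ($i<j$) are independent and uniform on $[0,1]$ and $g$ is any representative of $\gamma$. **Proposition.** Let $\gamma$ be a singular graphon with edge density $p$, let $n\ge1$, let $\varepsilon_1,\dots,\varepsilon_n$ be real numbers and $z\in\mathbb C$. Let $L_n(\gamma)=D-A$ be the Laplacian matrix (degree matrix minus adjacency matrix) of $G_n(\gamma)$. Then the random variable $\det\big((1+pz)I_n+z\,\mathrm{diag}(\varepsilon_1,\dots,\varepsilon_n)-\tfrac zn L_n(\gamma)\big)$ is integrable and $$\mathbb E\left[\det\Big((1+pz)I_n+z\,\mathrm{diag}(\varepsilon_1,\dots,\varepsilon_n)-\frac zn L_n(\gamma)\Big)\right]=\frac1n\sum_{i=1}^n(1+pz+\varepsilon_iz)\prod_{j\ne i}(1+\varepsilon_jz).$$ In particular, if $1+\varepsilon_iz\neq0$ for every $i$, this expectation is equal to $$\left(\prod_{i=1}^n(1+\varepsilon_iz)\right)\left(\frac1n\sum_{i=1}^n\frac{1+pz+\varepsilon_iz}{1+\varepsilon_iz}\right).$$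 -/

import Mathlib

open MeasureTheory ProbabilityTheory
open scoped unitInterval

noncomputable section

/-! ### Graph functions, the cut metric and graphons -/

/-- A graph function: a Borel function `[0,1]² → [0,1]`, symmetric almost everywhere. -/
structure GraphFunction where
  toFun : I → I → ℝ
  measurable_toFun : Measurable (fun q : I × I => toFun q.1 q.2)
  nonneg : ∀ x y, 0 ≤ toFun x y
  le_one : ∀ x y, toFun x y ≤ 1
  symm_ae : ∀ᵐ q : I × I, toFun q.1 q.2 = toFun q.2 q.1

/-- A Lebesgue isomorphism of `[0,1]`: a bijective bimeasurable map preserving Lebesgue measure.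
(The inverse of a bijective Borel map of `[0,1]` is automatically Borel.) -/
def LebesgueIso : Type :=
  {τ : I ≃ᵐ I // MeasurePreserving τ (volume : Measure I) (volume : Measure I)}

/-- The cut norm `sup_{S,T} |∫_{S × T} w|`, over pairs of measurable subsets of `[0,1]`. -/
def cutNorm (w : I → I → ℝ) : ℝ :=
  ⨆ S : {S : Set I // MeasurableSet S}, ⨆ T : {T : Set I // MeasurableSet T},
    |∫ q in S.1 ×ˢ T.1, w q.1 q.2|

/-- The cut metric `inf_τ ‖g₁^τ - g₂‖`, over the Lebesgue isomorphisms `τ`. -/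
def cutDist (g₁ g₂ : GraphFunction) : ℝ :=
  ⨅ τ : LebesgueIso, cutNorm (fun x y => g₁.toFun (τ.1 x) (τ.1 y) - g₂.toFun x y)

/-- Graphons: graph functions modulo the (equivalence) relation `cutDist g₁ g₂ = 0`. -/
def Graphon : Type := Quot (fun g₁ g₂ : GraphFunction => cutDist g₁ g₂ = 0)

/-- The graphon `[g]` of a graph function `g`. -/
def Graphon.mk (g : GraphFunction) : Graphon := Quot.mk _ g

/-! ### Homomorphism densities -/

open Classical in
/-- The edges of a graph on `{0, …, k-1}`, each listed once, as a pair `(i, j)` with `i < j`. -/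
def edgePairs {k : ℕ} (F : SimpleGraph (Fin k)) : Finset (Fin k × Fin k) :=
  Finset.univ.filter (fun e => e.1 < e.2 ∧ F.Adj e.1 e.2)

/-- `∫_{[0,1]^k} ∏_{{i,j} ∈ E_F} g(x_i, x_j) dx_1 ⋯ dx_k`. -/
def GraphFunction.homDensity (g : GraphFunction) {k : ℕ} (F : SimpleGraph (Fin k)) : ℝ :=
  ∫ x : Fin k → I, ∏ e ∈ edgePairs F, g.toFun (x e.1) (x e.2)

/-! The next facts show that the densities only depend on the graphon `[g]`. -/

theorem cutNorm_integrable {w : I → I → ℝ} (hw : Measurable (fun q : I × I => w q.1 q.2))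
    (hb : ∀ x y, |w x y| ≤ 1) : Integrable (fun q : I × I => w q.1 q.2) :=
  Integrable.of_bound hw.aestronglyMeasurable 1 (Filter.Eventually.of_forall fun q => hb q.1 q.2)

theorem abs_setIntegral_le_cutNorm {w : I → I → ℝ} (hb : ∀ x y, |w x y| ≤ 1)
    {S T : Set I} (hS : MeasurableSet S) (hT : MeasurableSet T) :
    |∫ q in S ×ˢ T, w q.1 q.2| ≤ cutNorm w := by
  have key : ∀ S T : Set I, |∫ q in S ×ˢ T, w q.1 q.2| ≤ 1 := by
    intro S T
    have h := norm_setIntegral_le_of_norm_le_const (μ := (volume : Measure (I × I)))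
      (s := S ×ˢ T) (f := fun q : I × I => w q.1 q.2) (C := 1) (measure_lt_top _ _)
      (fun q _ => hb q.1 q.2)
    rw [Real.norm_eq_abs] at h
    refine h.trans ?_
    rw [one_mul]
    exact measureReal_le_one
  have b1 : ∀ S : {S : Set I // MeasurableSet S}, BddAbove (Set.range
      fun T : {T : Set I // MeasurableSet T} => |∫ q in S.1 ×ˢ T.1, w q.1 q.2|) := by
    intro S
    refine ⟨1, ?_⟩
    rintro _ ⟨T, rfl⟩
    exact key _ _
  have : Nonempty {T : Set I // MeasurableSet T} := ⟨⟨∅, MeasurableSet.empty⟩⟩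
  have b2 : BddAbove (Set.range fun S : {S : Set I // MeasurableSet S} =>
      ⨆ T : {T : Set I // MeasurableSet T}, |∫ q in S.1 ×ˢ T.1, w q.1 q.2|) := by
    refine ⟨1, ?_⟩
    rintro _ ⟨S, rfl⟩
    exact ciSup_le fun T => key _ _
  exact (le_ciSup (b1 ⟨S, hS⟩) ⟨T, hT⟩).trans (le_ciSup b2 ⟨S, hS⟩)

theorem exists_set_abs_integral_le {φ a : I → ℝ} (hφ : Integrable φ) (hφm : Measurable φ)
    (ha : Measurable a) (h0 : ∀ x, 0 ≤ a x) (h1 : ∀ x, a x ≤ 1) :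
    ∃ S : Set I, MeasurableSet S ∧ |∫ x, φ x * a x| ≤ |∫ x in S, φ x| := by
  have hP : MeasurableSet {x | 0 ≤ φ x} := measurableSet_le measurable_const hφm
  have hN : MeasurableSet {x | φ x ≤ 0} := measurableSet_le hφm measurable_const
  have hi : Integrable (fun x => φ x * a x) :=
    hφ.mul_bdd (c := 1) ha.aestronglyMeasurable
      (Filter.Eventually.of_forall fun x => by rw [Real.norm_of_nonneg (h0 x)]; exact h1 x)
  have up : ∫ x, φ x * a x ≤ ∫ x in {x | 0 ≤ φ x}, φ x := by
    rw [← integral_indicator hP]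
    refine integral_mono hi (hφ.indicator hP) fun x => ?_
    by_cases hx : 0 ≤ φ x
    · simp only [Set.indicator, Set.mem_ofPred_eq, hx, if_true]
      nlinarith [h1 x]
    · simp only [Set.indicator, Set.mem_ofPred_eq, hx, if_false]
      nlinarith [h0 x]
  have lo : ∫ x in {x | φ x ≤ 0}, φ x ≤ ∫ x, φ x * a x := by
    rw [← integral_indicator hN]
    refine integral_mono (hφ.indicator hN) hi fun x => ?_
    by_cases hx : φ x ≤ 0
    · simp only [Set.indicator, Set.mem_ofPred_eq, hx, if_true]
      nlinarith [h1 x]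
    · simp only [Set.indicator, Set.mem_ofPred_eq, hx, if_false]
      nlinarith [h0 x]
  rcases le_total 0 (∫ x, φ x * a x) with h | h
  · exact ⟨_, hP, by rw [abs_of_nonneg h]; exact up.trans (le_abs_self _)⟩
  · exact ⟨_, hN, by rw [abs_of_nonpos h]; exact (neg_le_neg lo).trans (neg_le_abs _)⟩

theorem abs_integral_mul_le_cutNorm {w : I → I → ℝ}
    (hw : Measurable (fun q : I × I => w q.1 q.2)) (hb : ∀ x y, |w x y| ≤ 1)
    {a b : I → ℝ} (ha : Measurable a) (hb' : Measurable b)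
    (ha0 : ∀ x, 0 ≤ a x) (ha1 : ∀ x, a x ≤ 1) (hb0 : ∀ x, 0 ≤ b x) (hb1 : ∀ x, b x ≤ 1) :
    |∫ x, ∫ y, w x y * (a x * b y)| ≤ cutNorm w := by
  have hwi := cutNorm_integrable hw hb
  have hwb : Integrable (fun q : I × I => w q.1 q.2 * b q.2) :=
    hwi.mul_bdd (c := 1) (hb'.comp measurable_snd).aestronglyMeasurable
      (Filter.Eventually.of_forall fun q => by
        rw [Real.norm_of_nonneg (hb0 _)]; exact hb1 _)
  have hwbm : Measurable (fun q : I × I => w q.1 q.2 * b q.2) :=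
    hw.mul (hb'.comp measurable_snd)
  obtain ⟨S, hS, h1⟩ := exists_set_abs_integral_le (φ := fun x => ∫ y, w x y * b y)
    hwb.integral_prod_left
    (hwbm.stronglyMeasurable.integral_prod_right).measurable ha ha0 ha1
  have e1 : ∫ x, ∫ y, w x y * (a x * b y) = ∫ x, (∫ y, w x y * b y) * a x := by
    refine integral_congr_ae (Filter.Eventually.of_forall fun x => ?_)
    simp only
    rw [← integral_mul_const]
    refine integral_congr_ae (Filter.Eventually.of_forall fun y => ?_)
    simp only
    ring
  have hwS : Integrable (fun q : I × I => w q.1 q.2)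
      (((volume : Measure I).restrict S).prod (volume : Measure I)) := by
    have := hwi.restrict (s := S ×ˢ Set.univ)
    rwa [Measure.volume_eq_prod, ← Measure.prod_restrict, Measure.restrict_univ] at this
  have hwbS : Integrable (fun q : I × I => w q.1 q.2 * b q.2)
      (((volume : Measure I).restrict S).prod (volume : Measure I)) := by
    have := hwb.restrict (s := S ×ˢ Set.univ)
    rwa [Measure.volume_eq_prod, ← Measure.prod_restrict, Measure.restrict_univ] at this
  have hsw : Measurable (fun q : I × I => w q.2 q.1) := hw.comp measurable_swap
  obtain ⟨T, hT, h2⟩ := exists_set_abs_integral_le (φ := fun y => ∫ x in S, w x y)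
    hwS.integral_prod_right
    (hsw.stronglyMeasurable.integral_prod_right (ν := (volume : Measure I).restrict S)).measurable
    hb' hb0 hb1
  have e2 : ∫ x in S, ∫ y, w x y * b y = ∫ y, (∫ x in S, w x y) * b y := by
    rw [integral_integral_swap hwbS]
    refine integral_congr_ae (Filter.Eventually.of_forall fun y => ?_)
    simp only
    rw [integral_mul_const]
  have e3 : ∫ y in T, ∫ x in S, w x y = ∫ q in S ×ˢ T, w q.1 q.2 := by
    have hST : Integrable (fun q : I × I => w q.1 q.2)
        (((volume : Measure I).restrict S).prod ((volume : Measure I).restrict T)) := by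
      have := hwi.restrict (s := S ×ˢ T)
      rwa [Measure.volume_eq_prod, ← Measure.prod_restrict] at this
    rw [← integral_integral_swap hST, Measure.volume_eq_prod, ← Measure.prod_restrict,
      integral_prod _ hST]
  rw [e1]
  refine h1.trans ?_
  rw [e2]
  refine h2.trans ?_
  rw [e3]
  exact abs_setIntegral_le_cutNorm hb hS hT

theorem measurePreserving_update {k : ℕ} (i : Fin k) :
    MeasurePreserving (fun q : (Fin k → I) × I => Function.update q.1 i q.2)
      ((volume : Measure (Fin k → I)).prod (volume : Measure I)) volume := by
  have hm : Measurable (fun q : (Fin k → I) × I => Function.update q.1 i q.2) := by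
    rw [measurable_pi_iff]
    intro j
    by_cases h : j = i
    · subst h; simpa using measurable_snd
    · simp only [Function.update_of_ne h]; fun_prop
  refine ⟨hm, ?_⟩
  rw [volume_pi]
  symm
  refine Measure.pi_eq fun s hs => ?_
  rw [Measure.map_apply hm (MeasurableSet.univ_pi hs)]
  have : (fun q : (Fin k → I) × I => Function.update q.1 i q.2) ⁻¹' (Set.univ.pi s)
      = (Set.univ.pi (Function.update s i Set.univ)) ×ˢ (s i) := by
    ext q
    simp only [Set.mem_preimage, Set.mem_pi, Set.mem_univ, true_implies, Set.mem_prod]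
    constructor
    · intro h
      refine ⟨fun j => ?_, by simpa using h i⟩
      by_cases hj : j = i
      · subst hj; simp
      · simpa [Function.update_of_ne hj] using h j
    · rintro ⟨h, h'⟩ j
      by_cases hj : j = i
      · subst hj; simpa using h'
      · simpa [Function.update_of_ne hj] using h j
  rw [this, Measure.prod_prod, Measure.pi_pi,
    ← Finset.mul_prod_erase Finset.univ (fun j => volume (s j)) (Finset.mem_univ i), mul_comm,
    ← Finset.mul_prod_erase Finset.univ _ (Finset.mem_univ i)]
  simp only [Function.update_self, measure_univ, one_mul]
  congr 1
  refine Finset.prod_congr rfl fun j hj => ?_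
  rw [Function.update_of_ne (Finset.ne_of_mem_erase hj)]

theorem integral_update {k : ℕ} (i : Fin k) {f : (Fin k → I) → ℝ} (hf : Measurable f)
    {C : ℝ} (hC : ∀ x, |f x| ≤ C) :
    ∫ x, f x = ∫ x : Fin k → I, ∫ u : I, f (Function.update x i u) := by
  have mp := measurePreserving_update i
  have h := integral_map (μ := (volume : Measure (Fin k → I)).prod (volume : Measure I))
    mp.measurable.aemeasurable (f := f) hf.aestronglyMeasurable
  rw [mp.map_eq] at h
  rw [h]
  refine integral_prod (fun q : (Fin k → I) × I => f (Function.update q.1 i q.2)) ?_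
  exact Integrable.of_bound (hf.comp mp.measurable).aestronglyMeasurable C
    (Filter.Eventually.of_forall fun q => hC _)

theorem abs_integral_factor_le {k : ℕ} {i j : Fin k} (hij : i ≠ j) {w : I → I → ℝ}
    (hw : Measurable (fun q : I × I => w q.1 q.2)) (hb : ∀ x y, |w x y| ≤ 1)
    {A B : (Fin k → I) → ℝ} (hA : Measurable A) (hB : Measurable B)
    (hA0 : ∀ x, 0 ≤ A x) (hA1 : ∀ x, A x ≤ 1) (hB0 : ∀ x, 0 ≤ B x) (hB1 : ∀ x, B x ≤ 1)
    (hAj : ∀ x v, A (Function.update x j v) = A x)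
    (hBi : ∀ x u, B (Function.update x i u) = B x) :
    |∫ x, w (x i) (x j) * (A x * B x)| ≤ cutNorm w := by
  have hw' : Measurable (fun x : Fin k → I => w (x i) (x j)) :=
    hw.comp (g := fun q : I × I => w q.1 q.2) (f := fun x : Fin k → I => (x i, x j))
      ((measurable_pi_apply i).prodMk (measurable_pi_apply j))
  have hm : Measurable (fun x : Fin k → I => w (x i) (x j) * (A x * B x)) :=
    hw'.mul (hA.mul hB)
  have hbd : ∀ x : Fin k → I, |w (x i) (x j) * (A x * B x)| ≤ 1 := by
    intro x
    rw [abs_mul, abs_mul, abs_of_nonneg (hA0 x), abs_of_nonneg (hB0 x)]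
    exact mul_le_one₀ (hb _ _) (mul_nonneg (hA0 x) (hB0 x))
      (mul_le_one₀ (hA1 x) (hB0 x) (hB1 x))
  have mu : ∀ (l : Fin k) (x : Fin k → I), Measurable (fun u : I => Function.update x l u) :=
    fun l x => measurable_update x
  have e : ∀ x : Fin k → I,
      ∫ u : I, ∫ v : I, (fun x : Fin k → I => w (x i) (x j) * (A x * B x))
        (Function.update (Function.update x i u) j v)
      = ∫ u : I, ∫ v : I, w u v *
        (A (Function.update x i u) * B (Function.update x j v)) := by
    intro x
    refine integral_congr_ae (Filter.Eventually.of_forall fun u => ?_)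
    refine integral_congr_ae (Filter.Eventually.of_forall fun v => ?_)
    simp only [Function.update_self, Function.update_of_ne hij, hAj]
    rw [Function.update_comm hij, hBi]
  have e0 : ∫ x : Fin k → I, w (x i) (x j) * (A x * B x)
      = ∫ x : Fin k → I, ∫ u : I, ∫ v : I, w u v *
        (A (Function.update x i u) * B (Function.update x j v)) := by
    rw [integral_update j hm hbd]
    have mp := measurePreserving_update j
    have hm2 : Measurable (fun x : Fin k → I => ∫ v : I,
        (fun x : Fin k → I => w (x i) (x j) * (A x * B x)) (Function.update x j v)) := by
      have h3 : StronglyMeasurable (Function.uncurry fun (x : Fin k → I) (v : I) =>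
          (fun x : Fin k → I => w (x i) (x j) * (A x * B x)) (Function.update x j v)) :=
        (hm.comp mp.measurable).stronglyMeasurable
      exact (h3.integral_prod_right (ν := (volume : Measure I))).measurable
    rw [integral_update i hm2 (C := 1)]
    · exact integral_congr_ae (Filter.Eventually.of_forall fun x => e x)
    · intro x
      have := norm_integral_le_of_norm_le_const (μ := (volume : Measure I))
        (f := fun v : I => (fun x : Fin k → I => w (x i) (x j) * (A x * B x))
          (Function.update x j v)) (C := 1) (Filter.Eventually.of_forall fun v => hbd _)
      simpa using this
  rw [e0]
  have := norm_integral_le_of_norm_le_const (μ := (volume : Measure (Fin k → I)))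
    (f := fun x : Fin k → I => ∫ u : I, ∫ v : I, w u v *
        (A (Function.update x i u) * B (Function.update x j v))) (C := cutNorm w)
    (Filter.Eventually.of_forall fun x => by
      rw [Real.norm_eq_abs]
      exact abs_integral_mul_le_cutNorm hw hb (hA.comp (mu i x)) (hB.comp (mu j x))
        (fun _ => hA0 _) (fun _ => hA1 _) (fun _ => hB0 _) (fun _ => hB1 _))
  simpa using this

theorem measurable_prod_pairs {k : ℕ} (D : Finset (Fin k × Fin k))
    (h : Fin k × Fin k → GraphFunction) :
    Measurable (fun x : Fin k → I => ∏ e ∈ D, (h e).toFun (x e.1) (x e.2)) :=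
  Finset.measurable_prod _ fun e _ => (h e).measurable_toFun.comp
    (g := fun q : I × I => (h e).toFun q.1 q.2) (f := fun x : Fin k → I => (x e.1, x e.2))
    ((measurable_pi_apply e.1).prodMk (measurable_pi_apply e.2))

theorem prod_pairs_nonneg {k : ℕ} (D : Finset (Fin k × Fin k))
    (h : Fin k × Fin k → GraphFunction) (x : Fin k → I) :
    0 ≤ ∏ e ∈ D, (h e).toFun (x e.1) (x e.2) :=
  Finset.prod_nonneg fun e _ => (h e).nonneg _ _

theorem prod_pairs_le_one {k : ℕ} (D : Finset (Fin k × Fin k))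
    (h : Fin k × Fin k → GraphFunction) (x : Fin k → I) :
    ∏ e ∈ D, (h e).toFun (x e.1) (x e.2) ≤ 1 :=
  Finset.prod_le_one (fun e _ => (h e).nonneg _ _) fun e _ => (h e).le_one _ _

theorem abs_integral_replace_le {k : ℕ} (g₁ g₂ : GraphFunction)
    (h : Fin k × Fin k → GraphFunction) (e : Fin k × Fin k) (he : e.1 < e.2)
    (D : Finset (Fin k × Fin k)) (hD : ∀ f ∈ D, f.1 < f.2) (heD : e ∉ D) :
    |∫ x : Fin k → I, (g₁.toFun (x e.1) (x e.2) - g₂.toFun (x e.1) (x e.2)) *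
      ∏ f ∈ D, (h f).toFun (x f.1) (x f.2)|
      ≤ cutNorm (fun x y => g₁.toFun x y - g₂.toFun x y) := by
  classical
  have split : ∀ x : Fin k → I, ∏ f ∈ D, (h f).toFun (x f.1) (x f.2)
      = (∏ f ∈ D.filter (fun f => f.1 = e.1 ∨ f.2 = e.1), (h f).toFun (x f.1) (x f.2)) *
        ∏ f ∈ D.filter (fun f => ¬ (f.1 = e.1 ∨ f.2 = e.1)), (h f).toFun (x f.1) (x f.2) :=
    fun x => (Finset.prod_filter_mul_prod_filter_not _ _ _).symm
  simp only [split]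
  refine abs_integral_factor_le (w := fun x y => g₁.toFun x y - g₂.toFun x y) he.ne
    (g₁.measurable_toFun.sub g₂.measurable_toFun) ?_
    (measurable_prod_pairs _ h) (measurable_prod_pairs _ h)
    (prod_pairs_nonneg _ h) (prod_pairs_le_one _ h)
    (prod_pairs_nonneg _ h) (prod_pairs_le_one _ h) ?_ ?_
  · intro x y
    rw [abs_le]
    constructor <;>
      linarith [g₁.nonneg x y, g₁.le_one x y, g₂.nonneg x y, g₂.le_one x y]
  · intro x v
    refine Finset.prod_congr rfl fun f hf => ?_
    rw [Finset.mem_filter] at hf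
    have hf' := hD f hf.1
    have n1 : f.1 ≠ e.2 := by
      intro h1
      rcases hf.2 with h2 | h2
      · exact he.ne (h2.symm.trans h1)
      · rw [h1, h2] at hf'; exact lt_asymm he hf'
    have n2 : f.2 ≠ e.2 := by
      intro h1
      rcases hf.2 with h2 | h2
      · exact heD ((Prod.ext h2 h1 : f = e) ▸ hf.1)
      · exact he.ne (h2.symm.trans h1)
    rw [Function.update_of_ne n1, Function.update_of_ne n2]
  · intro x u
    refine Finset.prod_congr rfl fun f hf => ?_
    rw [Finset.mem_filter, not_or] at hf
    rw [Function.update_of_ne hf.2.1, Function.update_of_ne hf.2.2]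

theorem abs_integral_prod_sub_le {k : ℕ} (g₁ g₂ : GraphFunction)
    (E : Finset (Fin k × Fin k)) : ∀ D : Finset (Fin k × Fin k), (∀ f ∈ E, f.1 < f.2) →
    (∀ f ∈ D, f.1 < f.2) → Disjoint E D →
    |(∫ x : Fin k → I, (∏ f ∈ E, g₁.toFun (x f.1) (x f.2)) *
        ∏ f ∈ D, g₂.toFun (x f.1) (x f.2)) -
      ∫ x : Fin k → I, (∏ f ∈ E, g₂.toFun (x f.1) (x f.2)) *
        ∏ f ∈ D, g₂.toFun (x f.1) (x f.2)|
      ≤ E.card * cutNorm (fun x y => g₁.toFun x y - g₂.toFun x y) := by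
  classical
  have int : ∀ (E D : Finset (Fin k × Fin k)) (g g' : GraphFunction), Integrable
      (fun x : Fin k → I => (∏ f ∈ E, g.toFun (x f.1) (x f.2)) *
        ∏ f ∈ D, g'.toFun (x f.1) (x f.2)) := by
    intro E D g g'
    refine Integrable.of_bound ((measurable_prod_pairs E fun _ => g).mul
      (measurable_prod_pairs D fun _ => g')).aestronglyMeasurable 1
      (Filter.Eventually.of_forall fun x => ?_)
    have a0 := prod_pairs_nonneg E (fun _ => g) x
    have a1 := prod_pairs_le_one E (fun _ => g) x
    have b0 := prod_pairs_nonneg D (fun _ => g') x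
    have b1 := prod_pairs_le_one D (fun _ => g') x
    rw [Real.norm_of_nonneg (mul_nonneg a0 b0)]
    exact mul_le_one₀ a1 b0 b1
  induction E using Finset.induction_on with
  | empty => intro D _ _ _; simp
  | insert e E heE ih =>
    intro D hE hD hdis
    have he : e.1 < e.2 := hE e (Finset.mem_insert_self _ _)
    have hE' : ∀ f ∈ E, f.1 < f.2 := fun f hf => hE f (Finset.mem_insert_of_mem hf)
    rw [Finset.disjoint_insert_left] at hdis
    have step := abs_integral_replace_le g₁ g₂ (fun f => if f ∈ E then g₁ else g₂) e he (E ∪ D)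
      (fun f hf => (Finset.mem_union.1 hf).elim (hE' f) (hD f))
      (by rw [Finset.mem_union, not_or]; exact ⟨heE, hdis.1⟩)
    have ih' := ih (insert e D) hE'
      (fun f hf => (Finset.mem_insert.1 hf).elim (fun h => h ▸ he) (hD f))
      (Finset.disjoint_insert_right.2 ⟨heE, hdis.2⟩)
    have s1 : ∀ x : Fin k → I,
        (g₁.toFun (x e.1) (x e.2) - g₂.toFun (x e.1) (x e.2)) *
          ∏ f ∈ E ∪ D, (if f ∈ E then g₁ else g₂).toFun (x f.1) (x f.2)
        = (∏ f ∈ insert e E, g₁.toFun (x f.1) (x f.2)) *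
            (∏ f ∈ D, g₂.toFun (x f.1) (x f.2)) -
          (∏ f ∈ E, g₁.toFun (x f.1) (x f.2)) *
            ∏ f ∈ insert e D, g₂.toFun (x f.1) (x f.2) := by
      intro x
      rw [Finset.prod_union hdis.2, Finset.prod_insert heE, Finset.prod_insert hdis.1]
      have p1 : ∏ f ∈ E, (if f ∈ E then g₁ else g₂).toFun (x f.1) (x f.2)
          = ∏ f ∈ E, g₁.toFun (x f.1) (x f.2) :=
        Finset.prod_congr rfl fun f hf => by rw [if_pos hf]
      have p2 : ∏ f ∈ D, (if f ∈ E then g₁ else g₂).toFun (x f.1) (x f.2)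
          = ∏ f ∈ D, g₂.toFun (x f.1) (x f.2) :=
        Finset.prod_congr rfl fun f hf => by
          rw [if_neg (Finset.disjoint_right.1 hdis.2 hf)]
      rw [p1, p2]
      ring
    simp only [s1] at step
    rw [integral_sub (int _ _ _ _) (int _ _ _ _)] at step
    have s2 : ∫ x : Fin k → I, (∏ f ∈ E, g₂.toFun (x f.1) (x f.2)) *
          ∏ f ∈ insert e D, g₂.toFun (x f.1) (x f.2)
        = ∫ x : Fin k → I, (∏ f ∈ insert e E, g₂.toFun (x f.1) (x f.2)) *
          ∏ f ∈ D, g₂.toFun (x f.1) (x f.2) := by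
      refine integral_congr_ae (Filter.Eventually.of_forall fun x => ?_)
      simp only
      rw [Finset.prod_insert heE, Finset.prod_insert hdis.1]
      ring
    rw [s2] at ih'
    rw [Finset.card_insert_of_notMem heE]
    push_cast
    refine (abs_sub_le _ _ _).trans ((add_le_add step ih').trans (le_of_eq ?_))
    ring

theorem GraphFunction.abs_homDensity_sub_le (g₁ g₂ : GraphFunction) {k : ℕ}
    (F : SimpleGraph (Fin k)) :
    |g₁.homDensity F - g₂.homDensity F|
      ≤ (edgePairs F).card * cutNorm (fun x y => g₁.toFun x y - g₂.toFun x y) := by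
  have h := abs_integral_prod_sub_le g₁ g₂ (edgePairs F) ∅
    (fun f hf => by classical exact (Finset.mem_filter.1 hf).2.1) (fun f hf => absurd hf (Finset.notMem_empty f))
    (Finset.disjoint_empty_right _)
  simpa [GraphFunction.homDensity] using h

/-- The graph function `g^τ(x, y) = g(τ(x), τ(y))`. -/
def GraphFunction.precomp (g : GraphFunction) (τ : LebesgueIso) : GraphFunction where
  toFun x y := g.toFun (τ.1 x) (τ.1 y)
  measurable_toFun := g.measurable_toFun.comp
    ((τ.1.measurable.comp measurable_fst).prodMk (τ.1.measurable.comp measurable_snd))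
  nonneg _ _ := g.nonneg _ _
  le_one _ _ := g.le_one _ _
  symm_ae := (τ.2.prod τ.2).quasiMeasurePreserving.ae g.symm_ae

theorem GraphFunction.homDensity_precomp (g : GraphFunction) (τ : LebesgueIso) {k : ℕ}
    (F : SimpleGraph (Fin k)) : (g.precomp τ).homDensity F = g.homDensity F := by
  have mp : MeasurePreserving (fun (x : Fin k → I) (i : Fin k) => τ.1 (x i))
      (volume : Measure (Fin k → I)) volume :=
    volume_preserving_pi (fun _ => τ.2)
  have h := integral_map (μ := (volume : Measure (Fin k → I))) mp.measurable.aemeasurable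
    (measurable_prod_pairs (edgePairs F) fun _ => g).aestronglyMeasurable
  rw [mp.map_eq] at h
  exact h.symm

theorem GraphFunction.homDensity_eq_of_cutDist (g₁ g₂ : GraphFunction)
    (h : cutDist g₁ g₂ = 0) {k : ℕ} (F : SimpleGraph (Fin k)) :
    g₁.homDensity F = g₂.homDensity F := by
  have : Nonempty LebesgueIso := ⟨⟨MeasurableEquiv.refl I, MeasurePreserving.id _⟩⟩
  refine eq_of_abs_sub_le_all fun ε hε => ?_
  have hpos : 0 < ε / ((edgePairs F).card + 1 : ℝ) := by positivity
  obtain ⟨τ, hτ⟩ := exists_lt_of_ciInf_lt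
    (show cutDist g₁ g₂ < ε / ((edgePairs F).card + 1 : ℝ) by rw [h]; exact hpos)
  have hle := (g₁.precomp τ).abs_homDensity_sub_le g₂ F
  rw [g₁.homDensity_precomp τ F] at hle
  refine hle.trans ?_
  have h1 := mul_le_mul_of_nonneg_left hτ.le (Nat.cast_nonneg (α := ℝ) (edgePairs F).card)
  refine h1.trans ?_
  rw [mul_div_assoc', div_le_iff₀ (by positivity)]
  nlinarith

/-- The density `t(F, γ)` of the finite graph `F` in the graphon `γ`. -/
def Graphon.homDensity (γ : Graphon) {k : ℕ} (F : SimpleGraph (Fin k)) : ℝ :=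
  Quot.lift (fun g : GraphFunction => g.homDensity F)
    (fun g₁ g₂ h => g₁.homDensity_eq_of_cutDist g₂ h F) γ

/-- The edge density of a graphon: the density of the graph with two vertices and one edge. -/
def Graphon.edgeDensity (γ : Graphon) : ℝ := γ.homDensity (⊤ : SimpleGraph (Fin 2))

/-! ### Singular graphons -/

/-- The disjoint union of two graphs. The vertices of `F₁` come first. -/
def disjointUnion {k₁ k₂ : ℕ} (F₁ : SimpleGraph (Fin k₁)) (F₂ : SimpleGraph (Fin k₂)) :
    SimpleGraph (Fin (k₁ + k₂)) :=
  F₁.map (Fin.castAdd k₂) ⊔ F₂.map (Fin.natAdd k₁)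

/-- The graph obtained from the disjoint union of `F₁` and `F₂` by identifying the vertex `i₁` of
`F₁` with the vertex `i₂` of `F₂`. It has `k₁ + (k₂ + 1) - 1` vertices: those of `F₁` come first,
then those of `F₂` different from `i₂`, in their order. -/
def joinAt {k₁ k₂ : ℕ} (F₁ : SimpleGraph (Fin k₁)) (F₂ : SimpleGraph (Fin (k₂ + 1)))
    (i₁ : Fin k₁) (i₂ : Fin (k₂ + 1)) : SimpleGraph (Fin (k₁ + k₂)) :=
  F₁.map (Fin.castAdd k₂) ⊔
    F₂.map (Fin.insertNth (α := fun _ => Fin (k₁ + k₂)) i₂ (Fin.castAdd k₂ i₁)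
      (fun j => Fin.natAdd k₁ j))

/-- A graphon `γ` is singular if `t(F₁ ⊔ F₂, γ)` is the average, over the pairs of vertices
`(i₁, i₂)`, of `t((F₁ ⋈ F₂)(i₁, i₂), γ)`, for all non-empty finite graphs `F₁` and `F₂`, here with
`k₁ + 1` and `k₂ + 1` vertices. -/
def Graphon.IsSingular (γ : Graphon) : Prop :=
  ∀ (k₁ k₂ : ℕ) (F₁ : SimpleGraph (Fin (k₁ + 1))) (F₂ : SimpleGraph (Fin (k₂ + 1))),
    γ.homDensity (disjointUnion F₁ F₂)
      = 1 / (((k₁ : ℝ) + 1) * ((k₂ : ℝ) + 1)) *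
        ∑ i₁ : Fin (k₁ + 1), ∑ i₂ : Fin (k₂ + 1), γ.homDensity (joinAt F₁ F₂ i₁ i₂)

/-! ### W-random graphs -/

/-- The indices of the variables `X_i` and `U_{ij}`, `i < j`, that define `G_n(γ)`. -/
abbrev SampleIndex (n : ℕ) : Type := Fin n ⊕ {q : Fin n × Fin n // q.1 < q.2}

/-- The family `ξ`, made of the variables `X_i = ξ (inl i)` and `U_{ij} = ξ (inr (i, j))`, consists
of independent random variables which are uniformly distributed in `[0,1]`. -/
structure IsUniformSample {Ω : Type*} [MeasurableSpace Ω] (P : Measure Ω) {n : ℕ}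
    (ξ : SampleIndex n → Ω → I) : Prop where
  measurable : ∀ a, Measurable (ξ a)
  uniform : ∀ a, P.map (ξ a) = (volume : Measure I)
  indep : iIndepFun ξ P

/-- The graph on `{0, …, n-1}` in which `i < j` are adjacent if and only if
`U_{ij} ≤ g(X_i, X_j)`, where `X_i = ξ (inl i)` and `U_{ij} = ξ (inr (i, j))`. -/
def wRandomGraph (g : GraphFunction) {n : ℕ} (ξ : SampleIndex n → I) : SimpleGraph (Fin n) :=
  SimpleGraph.fromRel (fun i j => ∃ h : i < j,
    (ξ (Sum.inr ⟨(i, j), h⟩) : ℝ) ≤ g.toFun (ξ (Sum.inl i)) (ξ (Sum.inl j)))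

open Classical in
/-- The Laplacian matrix `L_G = D_G - A_G`, with complex entries. -/
def graphLaplacian {n : ℕ} (G : SimpleGraph (Fin n)) : Matrix (Fin n) (Fin n) ℂ :=
  G.lapMatrix ℂ

/-- The determinant of `(1 + p z) I_n + z diag(ε_1, …, ε_n) - z L_G / n`. -/
def modifiedLaplacianDet {n : ℕ} (G : SimpleGraph (Fin n)) (p : ℝ) (ε : Fin n → ℝ) (z : ℂ) : ℂ :=
  ((1 + (p : ℂ) * z) • (1 : Matrix (Fin n) (Fin n) ℂ)
    + z • Matrix.diagonal (fun i => (ε i : ℂ)) - (z / (n : ℂ)) • graphLaplacian G).det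

end

/-! Up to the scaling `-(z / n)`, every row of the random matrix is a sum over `j`: the slot `j = i`
contributes `c i • e_i`, with `c i = 1 + ε i * z + p * z`, and the slot `j ≠ i` contributes `w i j •
(e_i - e_j)`, where `w i j` is a multiple of the edge indicator. The determinant is multilinear in
the rows, so it expands over all maps `f` choosing one slot per row. The term of `f` is a monomial
in the indicators of the pairs `{i, f i}` with `f i ≠ i`, times a deterministic determinant.

That determinant vanishes as soon as `f` has a cycle of length at least 2, because the rows along
the cycle add up to zero (`det_functionalLaplacian_eq_zero`). In the surviving terms the pairs `{i,
f i}` are distinct and form a forest, so only forest densities matter for the expectation.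

Singularity tested on two single edges says that the degree function has second moment equal to the
square of its mean; its variance is zero and it is almost everywhere equal to `p`
(`Graphon.IsSingular.ae_degree_eq`). Removing leaves one at a time, a forest with `m` edges then
appears with probability `p ^ m` (`integral_prod_edgeIndicator`).

The expected determinant is therefore the one obtained by replacing every edge indicator by `p`
(`integral_det_weightedLaplacian`). With constant weights the matrix is a diagonal matrix plus a
rank-one matrix, whose determinant is explicit (`det_weightedLaplacian_const`). -/

noncomputable section

/-! ### Expanding a weighted Laplacian determinant over functional graphs -/

section Algebra

variable {ι R : Type*} [Fintype ι] [DecidableEq ι] [CommRing R]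

/-- The matrix `diag(c) + L_w`, where `L_w` is the Laplacian of the weights `w`: its `i`-th row is
`c i • e_i + ∑_{j ≠ i} w i j • (e_i - e_j)`. -/
def weightedLaplacian (c : ι → R) (w : ι → ι → R) : Matrix ι ι R :=
  Matrix.of fun i => ∑ j, (if j = i then c i else w i j) •
    (Pi.single i 1 - if j = i then 0 else Pi.single j 1 : ι → R)

theorem weightedLaplacian_apply (c : ι → R) (w : ι → ι → R) (i k : ι) :
    weightedLaplacian c w i k
      = if k = i then c i + ∑ j ∈ Finset.univ.erase i, w i j else - w i k := by
  have h : weightedLaplacian c w i k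
      = ∑ j, (if j = i then (if k = i then c i else 0) else
          w i j * ((if k = i then 1 else 0) - if k = j then 1 else 0)) := by
    rw [weightedLaplacian, Matrix.of_apply, Finset.sum_apply]
    refine Finset.sum_congr rfl fun j _ => ?_
    by_cases hj : j = i
    · subst hj; simp [Pi.single_apply]
    · simp [hj, Pi.single_apply]
  rw [h, ← Finset.add_sum_erase _ _ (Finset.mem_univ i), if_pos rfl]
  have h2 : ∀ j ∈ Finset.univ.erase i,
      (if j = i then (if k = i then c i else 0) else
          w i j * ((if k = i then 1 else 0) - if k = j then 1 else 0))
        = w i j * ((if k = i then 1 else 0) - if k = j then 1 else 0) := fun j hj => by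
    rw [if_neg (Finset.ne_of_mem_erase hj)]
  rw [Finset.sum_congr rfl h2]
  by_cases hk : k = i
  · simp only [hk, if_true]
    congr 1
    refine Finset.sum_congr rfl fun j hj => ?_
    rw [if_neg (Finset.ne_of_mem_erase hj).symm, sub_zero, mul_one]
  · simp [hk]

/-- The matrix with rows `e_i`, when `f i = i`, and `e_i - e_{f i}` otherwise. -/
def functionalLaplacian (R : Type*) [CommRing R] (f : ι → ι) : Matrix ι ι R :=
  Matrix.of fun i => (Pi.single i 1 - if f i = i then 0 else Pi.single (f i) 1 : ι → R)

/-- The determinant of `diag(c) + L_w` is a sum over the maps `f : ι → ι`. -/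
theorem det_weightedLaplacian (c : ι → R) (w : ι → ι → R) :
    (weightedLaplacian c w).det
      = ∑ f : ι → ι, (∏ i ∈ Finset.univ.filter (fun i => f i = i), c i) *
          (∏ i ∈ Finset.univ.filter (fun i => f i ≠ i), w i (f i)) *
          (functionalLaplacian R f).det := by
  -- Multilinear expansion: `f i` is the slot chosen in row `i`, and a fixed point of `f` is a row
  -- that chooses `c i`.
  have h := (Matrix.detRowAlternating (R := R) (n := ι)).toMultilinearMap.map_sum
    (fun i j => (if j = i then c i else w i j) •
      (Pi.single i 1 - if j = i then 0 else Pi.single j 1 : ι → R))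
  refine h.trans (Finset.sum_congr rfl fun f _ => ?_)
  rw [MultilinearMap.map_smul_univ, Finset.prod_ite, smul_eq_mul]
  rfl

/-- A map `f` without a non-empty set of non-fixed points contained in its own image: the only
cycles of `f` are its fixed points. -/
def IsForestMap (f : ι → ι) : Prop :=
  ∀ S : Finset ι, S.Nonempty → (∀ i ∈ S, f i ≠ i) → ¬ S ⊆ S.image f

/-- A finite set contained in its image under `f` is permuted by `f`, so the rows `e_i - e_{f i}`
indexed by it sum to zero. This also removes 2-cycles, where one edge would be counted twice. -/
theorem det_functionalLaplacian_eq_zero [IsDomain R] {f : ι → ι} (hf : ¬ IsForestMap f) :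
    (functionalLaplacian R f).det = 0 := by
  unfold IsForestMap at hf
  push Not at hf
  obtain ⟨S, hS, hne, hsub⟩ := hf
  have himg : S.image f = S :=
    (Finset.eq_of_subset_of_card_le hsub Finset.card_image_le).symm
  have hinj : Set.InjOn f S := Finset.card_image_iff.1 (by rw [himg])
  -- The indicator of `S` is a non-zero vector in the left kernel.
  refine Matrix.exists_vecMul_eq_zero_iff.1 ⟨fun i => if i ∈ S then 1 else 0, ?_, ?_⟩
  · obtain ⟨i, hi⟩ := hS
    intro h
    simpa [hi] using congrFun h i
  · funext k
    have h1 : ∑ i ∈ S, (Pi.single i 1 : ι → R) k = ∑ i ∈ S, (Pi.single (f i) 1 : ι → R) k := by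
      conv_lhs => rw [← himg]
      rw [Finset.sum_image hinj]
    simp only [Matrix.vecMul, dotProduct, ite_mul, one_mul, zero_mul, functionalLaplacian,
      Matrix.of_apply, Pi.sub_apply, Pi.zero_apply]
    rw [← Finset.sum_filter, Finset.filter_mem_eq_inter, Finset.univ_inter]
    rw [Finset.sum_congr rfl fun i hi => by rw [if_neg (hne i hi)], Finset.sum_sub_distrib, h1,
      sub_self]

end Algebra

/-! ### The determinant with constant weights -/

theorem det_diagonal_add_const {ι : Type*} [Fintype ι] [DecidableEq ι] (a : ι → ℂ) (s : ℂ) :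
    (Matrix.diagonal a + Matrix.of fun _ _ => s).det
      = ∏ i, a i + s * ∑ i, ∏ j ∈ Finset.univ.erase i, a j := by
  -- When the diagonal is invertible, this is the matrix determinant lemma, the constant matrix
  -- being a column of `s` times a row of ones.
  have generic : ∀ b : ι → ℂ, (∀ i, b i ≠ 0) →
      (Matrix.diagonal b + Matrix.of fun _ _ => s).det
        = ∏ i, b i + s * ∑ i, ∏ j ∈ Finset.univ.erase i, b j := by
    intro b hb
    have hdet : IsUnit (Matrix.diagonal b).det := by
      rw [Matrix.det_diagonal]
      exact (Finset.prod_ne_zero_iff.2 fun i _ => hb i).isUnit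
    have h := Matrix.det_add_replicateCol_mul_replicateRow (ι := Unit) hdet (fun _ => s)
      (fun _ => 1)
    have e : Matrix.replicateCol Unit (fun _ : ι => s) *
          Matrix.replicateRow Unit (fun _ : ι => (1 : ℂ))
        = Matrix.of fun _ _ => s := by
      ext i j
      simp [Matrix.mul_apply]
    have hinv : (Matrix.diagonal b)⁻¹ = Matrix.diagonal fun i => (b i)⁻¹ := by
      refine Matrix.inv_eq_right_inv ?_
      rw [Matrix.diagonal_mul_diagonal, ← Matrix.diagonal_one]
      congr 1
      funext i
      exact mul_inv_cancel₀ (hb i)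
    rw [e, hinv, Matrix.det_diagonal, Matrix.det_unique (n := Unit)] at h
    rw [h]
    simp only [Matrix.add_apply, Matrix.mul_apply, Matrix.replicateRow_apply,
      Matrix.replicateCol_apply, Matrix.one_apply_eq, Matrix.diagonal_apply, one_mul, mul_ite,
      mul_zero, Finset.sum_ite_eq', Finset.mem_univ, if_true]
    rw [mul_add, mul_one, Finset.mul_sum, Finset.mul_sum]
    congr 1
    refine Finset.sum_congr rfl fun i _ => ?_
    rw [← Finset.mul_prod_erase Finset.univ b (Finset.mem_univ i)]
    field_simp [hb i]
  -- Zeros on the diagonal are handled by shifting it by `t`: both sides are continuous in `t`, and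
  -- they agree off the finitely many `t` for which some `a i + t` vanishes.
  have hdense : Dense (Finset.univ.image fun i => - a i : Set ℂ)ᶜ :=
    (Finset.finite_toSet _).countable.dense_compl ℝ
  have hext := Continuous.ext_on hdense
    (f := fun t : ℂ => (Matrix.diagonal (fun i => a i + t) + Matrix.of fun _ _ => s).det)
    (g := fun t : ℂ => ∏ i, (a i + t) + s * ∑ i, ∏ j ∈ Finset.univ.erase i, (a j + t))
    (by fun_prop) (by fun_prop) (fun t ht => generic _ fun i hi => ht (by
      simpa using ⟨i, by linear_combination -hi⟩))
  simpa using congrFun hext 0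

/-- The diagonal entries are `a i + t - (n - 1) * t / n = a i + t / n` and the others `t / n`, so
this is `diag(a)` plus a constant matrix. The product of all the `a i` is then written as the
average over `i` of `a i * ∏ j ≠ i, a j`. -/
theorem det_weightedLaplacian_const {n : ℕ} (hn : 1 ≤ n) (a : Fin n → ℂ) (t : ℂ) :
    (weightedLaplacian (fun i => a i + t) (fun _ _ => -(t / n))).det
      = 1 / n * ∑ i, (a i + t) * ∏ j ∈ Finset.univ.erase i, a j := by
  have hn0 : (n : ℂ) ≠ 0 := Nat.cast_ne_zero.2 (by omega)
  have e : weightedLaplacian (fun i => a i + t) (fun _ _ => -(t / n))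
      = Matrix.diagonal a + Matrix.of fun _ _ => t / n := by
    ext i k
    rw [weightedLaplacian_apply]
    by_cases hk : k = i
    · subst hk
      simp only [if_true, Finset.sum_const, Finset.card_erase_of_mem (Finset.mem_univ k),
        Finset.card_univ, Fintype.card_fin, nsmul_eq_mul, Matrix.add_apply,
        Matrix.diagonal_apply_eq, Matrix.of_apply, Nat.cast_sub hn, Nat.cast_one]
      field_simp
      ring
    · simp [hk, Matrix.diagonal_apply_ne _ (Ne.symm hk)]
  rw [e, det_diagonal_add_const]
  simp only [add_mul, Finset.sum_add_distrib, Finset.mul_prod_erase _ _ (Finset.mem_univ _),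
    ← Finset.mul_sum, Finset.sum_const, Finset.card_univ, Fintype.card_fin, nsmul_eq_mul]
  field_simp

/-- Puts the matrix in the form to which the expansion over maps applies; the absence of loops makes
the degree a sum over `j ≠ i`. -/
theorem modifiedLaplacian_eq_weightedLaplacian {n : ℕ} (G : SimpleGraph (Fin n))
    [DecidableRel G.Adj] (p : ℝ) (ε : Fin n → ℝ) (z : ℂ) :
    modifiedLaplacianDet G p ε z
      = (weightedLaplacian (fun i => (1 + ε i * z) + p * z)
          (fun i j => -(z / n) * if G.Adj i j then 1 else 0)).det := by
  rw [modifiedLaplacianDet]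
  congr 1
  ext i k
  have hdeg : (G.degree i : ℂ) = ∑ j ∈ Finset.univ.erase i, if G.Adj i j then (1 : ℂ) else 0 := by
    rw [G.degree_eq_sum_if_adj, ← Finset.add_sum_erase _ _ (Finset.mem_univ i)]
    simp
  have hL : graphLaplacian G i k
      = if k = i then (G.degree i : ℂ) else -(if G.Adj i k then 1 else 0) := by
    rw [graphLaplacian, SimpleGraph.lapMatrix, SimpleGraph.degMatrix, Matrix.sub_apply,
      SimpleGraph.adjMatrix_apply]
    by_cases hk : k = i
    · subst hk
      simp
      congr!
    · rw [Matrix.diagonal_apply_ne _ (Ne.symm hk), if_neg hk, zero_sub]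
      congr!
  rw [weightedLaplacian_apply, ← Finset.mul_sum, ← hdeg]
  simp only [Matrix.sub_apply, Matrix.add_apply, Matrix.smul_apply, hL, smul_eq_mul]
  by_cases hk : k = i
  · subst hk; simp; ring
  · split_ifs <;>
      simp [Matrix.one_apply_ne (Ne.symm hk), Matrix.diagonal_apply_ne _ (Ne.symm hk)]

/-! ### Integrating out single coordinates -/

theorem measurable_kernel_pi {κ : Type*} {W : I → I → ℝ} (hW : Measurable (fun q : I × I => W q.1 q.2))
    (a b : κ) : Measurable (fun x : κ → I => W (x a) (x b)) :=
  hW.comp (g := fun q : I × I => W q.1 q.2) (f := fun x : κ → I => (x a, x b))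
    ((measurable_pi_apply a).prodMk (measurable_pi_apply b))

section Coordinates

variable {κ : Type*} [Fintype κ] [DecidableEq κ]

/-- Resampling one coordinate does not change the law: the preimage of a box is the box with side
`i` freed, times that side. The index type is arbitrary because it has to include both the vertex
variables and the pair variables. -/
theorem measurePreserving_update_pi (i : κ) :
    MeasurePreserving (fun q : (κ → I) × I => Function.update q.1 i q.2)
      ((volume : Measure (κ → I)).prod (volume : Measure I)) volume := by
  have hm : Measurable (fun q : (κ → I) × I => Function.update q.1 i q.2) := by
    rw [measurable_pi_iff]
    intro j
    by_cases h : j = i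
    · subst h; simpa using measurable_snd
    · simp only [Function.update_of_ne h]; fun_prop
  refine ⟨hm, ?_⟩
  rw [volume_pi]
  symm
  refine Measure.pi_eq fun s hs => ?_
  rw [Measure.map_apply hm (MeasurableSet.univ_pi hs)]
  have : (fun q : (κ → I) × I => Function.update q.1 i q.2) ⁻¹' (Set.univ.pi s)
      = (Set.univ.pi (Function.update s i Set.univ)) ×ˢ (s i) := by
    ext q
    simp only [Set.mem_preimage, Set.mem_pi, Set.mem_univ, true_implies, Set.mem_prod]
    constructor
    · intro h
      refine ⟨fun j => ?_, by simpa using h i⟩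
      by_cases hj : j = i
      · subst hj; simp
      · simpa [Function.update_of_ne hj] using h j
    · rintro ⟨h, h'⟩ j
      by_cases hj : j = i
      · subst hj; simpa using h'
      · simpa [Function.update_of_ne hj] using h j
  rw [this, Measure.prod_prod, Measure.pi_pi,
    ← Finset.mul_prod_erase Finset.univ (fun j => volume (s j)) (Finset.mem_univ i), mul_comm,
    ← Finset.mul_prod_erase Finset.univ _ (Finset.mem_univ i)]
  simp only [Function.update_self, measure_univ, one_mul]
  congr 1
  refine Finset.prod_congr rfl fun j hj => ?_
  rw [Function.update_of_ne (Finset.ne_of_mem_erase hj)]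

theorem integral_update_pi (i : κ) {f : (κ → I) → ℝ} (hf : Measurable f)
    {C : ℝ} (hC : ∀ x, |f x| ≤ C) :
    ∫ x, f x = ∫ x : κ → I, ∫ u : I, f (Function.update x i u) := by
  have mp := measurePreserving_update_pi i
  have h := integral_map (μ := (volume : Measure (κ → I)).prod (volume : Measure I))
    mp.measurable.aemeasurable (f := f) hf.aestronglyMeasurable
  rw [mp.map_eq] at h
  rw [h]
  refine integral_prod (fun q : (κ → I) × I => f (Function.update q.1 i q.2)) ?_
  exact Integrable.of_bound (hf.comp mp.measurable).aestronglyMeasurable C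
    (Filter.Eventually.of_forall fun q => hC _)

/-- Integrating out the coordinate `a`, on which only the factor `W (x a) (x b)` depends. -/
theorem integral_kernel_mul {a b : κ} (hab : b ≠ a) {W : I → I → ℝ}
    (hW : Measurable (fun q : I × I => W q.1 q.2)) (hW1 : ∀ x y, |W x y| ≤ 1)
    {R : (κ → I) → ℝ} (hR : Measurable R) (hR1 : ∀ x, |R x| ≤ 1)
    (hRa : ∀ x v, R (Function.update x a v) = R x) :
    ∫ x, W (x a) (x b) * R x = ∫ x, (∫ v, W v (x b)) * R x := by
  rw [integral_update_pi a (f := fun x => W (x a) (x b) * R x)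
    ((measurable_kernel_pi hW a b).mul hR) (C := 1)]
  · simp only [Function.update_self, Function.update_of_ne hab, hRa, integral_mul_const]
  · intro x
    rw [abs_mul]
    exact mul_le_one₀ (hW1 _ _) (abs_nonneg _) (hR1 _)

theorem integral_threshold (c : ℝ) (h0 : 0 ≤ c) (h1 : c ≤ 1) :
    ∫ u : I, (if (u : ℝ) ≤ c then (1 : ℝ) else 0) = c := by
  have h := integral_indicator_one (μ := (volume : Measure I))
    (measurableSet_Iic (a := (⟨c, h0, h1⟩ : I)))
  rw [measureReal_def, unitInterval.volume_Iic, ENNReal.toReal_ofReal h0] at h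
  refine Eq.trans ?_ h
  rfl

/-- Integrating out a threshold variable `x q` and a coordinate `x a`, for a kernel `W` whose
integrals over the first variable are all equal to `p`. -/
theorem integral_threshold_kernel_mul {a b q : κ} (hba : b ≠ a) (haq : a ≠ q) (hbq : b ≠ q)
    {W : I → I → ℝ} (hW : Measurable (fun q : I × I => W q.1 q.2)) (h0 : ∀ x y, 0 ≤ W x y)
    (h1 : ∀ x y, W x y ≤ 1) {p : ℝ} (hp : ∀ᵐ y, ∫ v, W v y = p)
    {R : (κ → I) → ℝ} (hR : Measurable R) (hR1 : ∀ x, |R x| ≤ 1)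
    (hRa : ∀ x v, R (Function.update x a v) = R x)
    (hRq : ∀ x v, R (Function.update x q v) = R x) :
    ∫ x, (if (x q : ℝ) ≤ W (x a) (x b) then 1 else 0) * R x = p * ∫ x, R x := by
  have hm : Measurable (fun x : κ → I => if (x q : ℝ) ≤ W (x a) (x b) then (1 : ℝ) else 0) :=
    Measurable.ite (measurableSet_le (measurable_subtype_coe.comp (measurable_pi_apply q))
      (measurable_kernel_pi hW a b)) measurable_const measurable_const
  rw [integral_update_pi q (f := fun x => (if (x q : ℝ) ≤ W (x a) (x b) then 1 else 0) * R x)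
    (hm.mul hR) (C := 1)]
  · simp only [Function.update_self, Function.update_of_ne haq, Function.update_of_ne hbq, hRq,
      integral_mul_const]
    -- Averaging the threshold first turns the indicator into the kernel; the coordinate `a` can
    -- then be integrated out.
    simp only [integral_threshold _ (h0 _ _) (h1 _ _)]
    rw [integral_kernel_mul hba hW (fun x y => abs_le.2 ⟨by linarith [h0 x y], h1 x y⟩) hR hR1 hRa,
      ← integral_const_mul]
    refine integral_congr_ae ?_
    have mp : MeasurePreserving (fun x : κ → I => x b) volume volume :=
      measurePreserving_eval (fun _ => volume) b
    filter_upwards [mp.quasiMeasurePreserving.ae hp] with x hx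
    rw [hx]
  · intro x
    rw [abs_mul]
    refine mul_le_one₀ ?_ (abs_nonneg _) (hR1 _)
    split_ifs <;> simp

end Coordinates

/-! ### Singular graphons have constant degrees -/

namespace GraphFunction

/-- The degree `∫ g(x, y) dx`. -/
def degree (g : GraphFunction) (y : I) : ℝ := ∫ x, g.toFun x y

theorem measurable_swap (g : GraphFunction) :
    Measurable (fun q : I × I => g.toFun q.2 q.1) := g.measurable_toFun.comp _root_.measurable_swap

theorem abs_le_one (g : GraphFunction) (x y : I) : |g.toFun x y| ≤ 1 :=
  abs_le.2 ⟨by linarith [g.nonneg x y], g.le_one x y⟩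

theorem measurable_degree (g : GraphFunction) : Measurable g.degree :=
  (g.measurable_swap.stronglyMeasurable.integral_prod_right (ν := (volume : Measure I))).measurable

theorem abs_degree_le_one (g : GraphFunction) (y : I) : |g.degree y| ≤ 1 := by
  have := norm_integral_le_of_norm_le_const (μ := (volume : Measure I))
    (f := fun x => g.toFun x y) (C := 1) (Filter.Eventually.of_forall fun x => g.abs_le_one x y)
  simpa [degree] using this

/-- Symmetry holds only almost everywhere, so the two marginals are compared through Fubini and
agree only for almost every `x`. -/
theorem ae_integral_right_eq_degree (g : GraphFunction) :
    ∀ᵐ x, ∫ y, g.toFun x y = g.degree x := by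
  have h := g.symm_ae
  rw [Measure.volume_eq_prod] at h
  filter_upwards [Measure.ae_ae_of_ae_prod h] with x hx
  exact integral_congr_ae hx

theorem integrable_degree (g : GraphFunction) : Integrable g.degree :=
  Integrable.of_bound g.measurable_degree.aestronglyMeasurable 1
    (Filter.Eventually.of_forall g.abs_degree_le_one)

theorem measurable_degree_pi {k : ℕ} (g : GraphFunction) (b : Fin k) :
    Measurable (fun x : Fin k → I => g.degree (x b)) :=
  g.measurable_degree.comp (measurable_pi_apply b)

theorem integral_comp_eval {k : ℕ} (b : Fin k) {φ : I → ℝ} (hφ : Measurable φ) :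
    ∫ x : Fin k → I, φ (x b) = ∫ y, φ y := by
  have mp : MeasurePreserving (fun x : Fin k → I => x b) volume volume := measurePreserving_eval (fun _ => volume) b
  have h := integral_map (μ := (volume : Measure (Fin k → I))) mp.measurable.aemeasurable
    (f := φ) hφ.aestronglyMeasurable
  rw [mp.map_eq] at h
  exact h.symm

theorem integral_left_mul {k : ℕ} (g : GraphFunction) {a b : Fin k} (hab : b ≠ a)
    {R : (Fin k → I) → ℝ} (hR : Measurable R) (hR1 : ∀ x, |R x| ≤ 1)
    (hRa : ∀ x v, R (Function.update x a v) = R x) :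
    ∫ x, g.toFun (x a) (x b) * R x = ∫ x, g.degree (x b) * R x :=
  integral_kernel_mul hab g.measurable_toFun g.abs_le_one hR hR1 hRa

theorem integral_right_mul {k : ℕ} (g : GraphFunction) {a b : Fin k} (hab : b ≠ a)
    {R : (Fin k → I) → ℝ} (hR : Measurable R) (hR1 : ∀ x, |R x| ≤ 1)
    (hRa : ∀ x v, R (Function.update x a v) = R x) :
    ∫ x, g.toFun (x b) (x a) * R x = ∫ x, g.degree (x b) * R x := by
  rw [integral_kernel_mul (W := fun x y => g.toFun y x) hab g.measurable_swap
    (fun x y => g.abs_le_one y x) hR hR1 hRa]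
  refine integral_congr_ae ?_
  have mp : MeasurePreserving (fun x : Fin k → I => x b) volume volume := measurePreserving_eval (fun _ => volume) b
  filter_upwards [mp.quasiMeasurePreserving.ae g.ae_integral_right_eq_degree] with x hx
  rw [hx]

/-- The density of the path with edges `{a, b}` and `{a, c}`. -/
theorem integral_path_center_left (g : GraphFunction) {k : ℕ} {a b c : Fin k} (hab : a ≠ b)
    (hac : a ≠ c) (hbc : b ≠ c) :
    ∫ x : Fin k → I, g.toFun (x a) (x b) * g.toFun (x a) (x c) = ∫ y, g.degree y ^ 2 := by
  rw [g.integral_right_mul hab (measurable_kernel_pi g.measurable_toFun a c)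
    (fun x => g.abs_le_one _ _)
    (fun x v => by rw [Function.update_of_ne hab, Function.update_of_ne hbc.symm])]
  simp_rw [mul_comm (g.degree _)]
  rw [g.integral_right_mul hac (g.measurable_degree_pi a) (fun x => g.abs_degree_le_one _)
    (fun x v => by rw [Function.update_of_ne hac])]
  simp_rw [← pow_two]
  exact integral_comp_eval a (φ := fun y => g.degree y ^ 2) (g.measurable_degree.pow_const 2)

/-- The density of the path with edges `{a, b}` and `{b, c}`. -/
theorem integral_path_center_middle (g : GraphFunction) {k : ℕ} {a b c : Fin k} (hab : a ≠ b)
    (hac : a ≠ c) (hbc : b ≠ c) :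
    ∫ x : Fin k → I, g.toFun (x a) (x b) * g.toFun (x b) (x c) = ∫ y, g.degree y ^ 2 := by
  rw [g.integral_left_mul hab.symm (measurable_kernel_pi g.measurable_toFun b c)
    (fun x => g.abs_le_one _ _)
    (fun x v => by rw [Function.update_of_ne hab.symm, Function.update_of_ne hac.symm])]
  simp_rw [mul_comm (g.degree _)]
  rw [g.integral_right_mul hbc (g.measurable_degree_pi b) (fun x => g.abs_degree_le_one _)
    (fun x v => by rw [Function.update_of_ne hbc])]
  simp_rw [← pow_two]
  exact integral_comp_eval b (φ := fun y => g.degree y ^ 2) (g.measurable_degree.pow_const 2)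

theorem integral_edge (g : GraphFunction) {k : ℕ} {a b : Fin k} (hab : a ≠ b) :
    ∫ x : Fin k → I, g.toFun (x a) (x b) = ∫ y, g.degree y := by
  have h := g.integral_left_mul hab.symm (R := fun _ => 1) measurable_const (by simp) (by simp)
  simp only [mul_one] at h
  rw [h, integral_comp_eval b g.measurable_degree]

theorem integral_two_edges (g : GraphFunction) {k : ℕ} {a b c d : Fin k} (hab : a ≠ b)
    (hac : a ≠ c) (had : a ≠ d) (hbc : b ≠ c) (hbd : b ≠ d) (hcd : c ≠ d) :
    ∫ x : Fin k → I, g.toFun (x a) (x b) * g.toFun (x c) (x d) = (∫ y, g.degree y) ^ 2 := by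
  rw [g.integral_left_mul hab.symm (measurable_kernel_pi g.measurable_toFun c d)
    (fun x => g.abs_le_one _ _)
    (fun x v => by rw [Function.update_of_ne hac.symm, Function.update_of_ne had.symm])]
  rw [integral_kernel_mul (W := fun x _ => g.degree x) (b := c) hbc.symm
    (g.measurable_degree.comp measurable_fst) (fun x _ => g.abs_degree_le_one x)
    (measurable_kernel_pi g.measurable_toFun c d) (fun x => g.abs_le_one _ _)
    (fun x v => by rw [Function.update_of_ne hbc.symm, Function.update_of_ne hbd.symm]),
    integral_const_mul, g.integral_edge hcd, pow_two]

theorem homDensity_edge (g : GraphFunction) :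
    g.homDensity (⊤ : SimpleGraph (Fin 2)) = ∫ y, g.degree y := by
  have h : edgePairs (⊤ : SimpleGraph (Fin 2)) = {(0, 1)} := by
    ext ⟨a, b⟩
    simp only [edgePairs, Finset.mem_filter, Finset.mem_univ, true_and, SimpleGraph.top_adj]
    revert a b
    decide
  simp only [homDensity, h, Finset.prod_singleton]
  exact g.integral_edge (by decide)

theorem homDensity_disjointUnion_edges (g : GraphFunction) :
    g.homDensity (disjointUnion (⊤ : SimpleGraph (Fin 2)) (⊤ : SimpleGraph (Fin 2)))
      = (∫ y, g.degree y) ^ 2 := by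
  have h : edgePairs (disjointUnion (⊤ : SimpleGraph (Fin 2)) (⊤ : SimpleGraph (Fin 2)))
      = {(0, 1), (2, 3)} := by
    ext ⟨a, b⟩
    simp only [edgePairs, Finset.mem_filter, Finset.mem_univ, true_and, disjointUnion,
      SimpleGraph.sup_adj, SimpleGraph.map_adj', SimpleGraph.top_adj]
    revert a b
    decide
  simp only [homDensity, h]
  simp_rw [Finset.prod_pair (show ((0, 1) : Fin (2 + 2) × Fin (2 + 2)) ≠ (2, 3) by decide)]
  exact g.integral_two_edges (by decide) (by decide) (by decide) (by decide) (by decide) (by decide)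

/-- Every gluing of two edges is a path on three vertices centred at `i₁`, the free end being the
vertex `2` whatever `i₂` is. -/
theorem homDensity_joinAt_edges (g : GraphFunction) (i₁ i₂ : Fin 2) :
    g.homDensity (joinAt (k₂ := 1) (⊤ : SimpleGraph (Fin 2)) (⊤ : SimpleGraph (Fin 2)) i₁ i₂)
      = ∫ y, g.degree y ^ 2 := by
  have h : edgePairs (joinAt (k₂ := 1) (⊤ : SimpleGraph (Fin 2)) (⊤ : SimpleGraph (Fin 2)) i₁ i₂)
      = {(0, 1), (Fin.castAdd 1 i₁, 2)} := by
    ext ⟨a, b⟩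
    simp only [edgePairs, Finset.mem_filter, Finset.mem_univ, true_and, joinAt,
      SimpleGraph.sup_adj, SimpleGraph.map_adj', SimpleGraph.top_adj]
    revert i₁ i₂ a b
    decide
  simp only [homDensity, h]
  have hne : ((0, 1) : Fin (2 + 1) × Fin (2 + 1)) ≠ (Fin.castAdd 1 i₁, 2) := by
    clear h i₂
    revert i₁
    decide
  simp_rw [Finset.prod_pair hne]
  fin_cases i₁
  · exact g.integral_path_center_left (by decide) (by decide) (by decide)
  · exact g.integral_path_center_middle (by decide) (by decide) (by decide)

end GraphFunction

/-- The degrees of a singular graphon are almost everywhere equal to its edge density. -/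
theorem Graphon.IsSingular.ae_degree_eq {γ : Graphon} (hγ : γ.IsSingular) {p : ℝ}
    (hp : γ.edgeDensity = p) {g : GraphFunction} (hg : Graphon.mk g = γ) :
    ∀ᵐ y, g.degree y = p := by
  subst hg
  have hp' : ∫ y, g.degree y = p := by rw [← hp, ← g.homDensity_edge]; rfl
  have hs := hγ 1 1 ⊤ ⊤
  -- The four gluings have the same density, so their average is the second moment of the degree.
  have hu : (∫ y, g.degree y) ^ 2 = ∫ y, g.degree y ^ 2 := by
    refine g.homDensity_disjointUnion_edges.symm.trans (hs.trans ?_)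
    have hj : ∀ i₁ i₂ : Fin 2, (Graphon.mk g).homDensity
        (joinAt (k₂ := 1) (⊤ : SimpleGraph (Fin 2)) (⊤ : SimpleGraph (Fin 2)) i₁ i₂)
        = ∫ y, g.degree y ^ 2 := g.homDensity_joinAt_edges
    simp only [Nat.reduceAdd, hj, Finset.sum_const, Finset.card_univ, Fintype.card_fin]
    norm_num
    ring
  have hi2 : Integrable (fun y => g.degree y ^ 2) :=
    Integrable.of_bound (g.measurable_degree.pow_const 2).aestronglyMeasurable 1
      (Filter.Eventually.of_forall fun y => by
        rw [Real.norm_eq_abs, abs_pow]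
        exact pow_le_one₀ (abs_nonneg _) (g.abs_degree_le_one y))
  have hi1 : Integrable (fun y => 2 * p * g.degree y) := g.integrable_degree.const_mul _
  have hvar : ∫ y, (g.degree y - p) ^ 2 = 0 := by
    have e : ∀ y, (g.degree y - p) ^ 2 = g.degree y ^ 2 - 2 * p * g.degree y + p ^ 2 :=
      fun y => by ring
    simp_rw [e]
    rw [integral_add (f := fun y => g.degree y ^ 2 - 2 * p * g.degree y) (hi2.sub hi1)
      (integrable_const _), integral_sub hi2 hi1,
      integral_const_mul, ← hu, hp']
    simp
    ring
  have hi3 : Integrable (fun y => (g.degree y - p) ^ 2) :=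
    ((hi2.sub hi1).add (integrable_const (p ^ 2))).congr
      (Filter.Eventually.of_forall fun y => by simp only [Pi.add_apply, Pi.sub_apply]; ring)
  filter_upwards [(integral_eq_zero_iff_of_nonneg (fun y => sq_nonneg _) hi3).1 hvar] with y hy
  exact sub_eq_zero.1 (pow_eq_zero_iff two_ne_zero |>.1 hy)

/-! ### Forest densities of W-random graphs -/

section RandomGraph

variable {n : ℕ}

open Classical in
/-- The indicator that `i` and `j` are adjacent in the W-random graph. -/
def edgeIndicator (g : GraphFunction) (i j : Fin n) (x : SampleIndex n → I) : ℝ :=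
  if (wRandomGraph g x).Adj i j then 1 else 0

theorem edgeIndicator_symm (g : GraphFunction) (i j : Fin n) (x : SampleIndex n → I) :
    edgeIndicator g i j x = edgeIndicator g j i x := by
  classical
  simp only [edgeIndicator]
  exact if_congr (SimpleGraph.adj_comm _ i j) rfl rfl

theorem edgeIndicator_self (g : GraphFunction) (i : Fin n) (x : SampleIndex n → I) :
    edgeIndicator g i i x = 0 := by
  simp [edgeIndicator]

theorem edgeIndicator_of_lt (g : GraphFunction) {i j : Fin n} (h : i < j)
    (x : SampleIndex n → I) :
    edgeIndicator g i j x = if (x (Sum.inr ⟨(i, j), h⟩) : ℝ)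
      ≤ g.toFun (x (Sum.inl i)) (x (Sum.inl j)) then 1 else 0 := by
  have e : (wRandomGraph g x).Adj i j ↔ (x (Sum.inr ⟨(i, j), h⟩) : ℝ)
      ≤ g.toFun (x (Sum.inl i)) (x (Sum.inl j)) := by
    rw [wRandomGraph, SimpleGraph.fromRel_adj]
    constructor
    · rintro ⟨-, ⟨_, h'⟩ | ⟨h', _⟩⟩
      · exact h'
      · exact absurd h' h.asymm
    · exact fun h' => ⟨h.ne, Or.inl ⟨h, h'⟩⟩
  rw [edgeIndicator]
  simp only [e]

theorem abs_edgeIndicator_le_one (g : GraphFunction) (i j : Fin n) (x : SampleIndex n → I) :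
    |edgeIndicator g i j x| ≤ 1 := by
  rw [edgeIndicator]
  split_ifs <;> simp

theorem measurable_edgeIndicator (g : GraphFunction) (i j : Fin n) :
    Measurable (edgeIndicator g i j) := by
  have lt : ∀ i j : Fin n, i < j → Measurable (edgeIndicator g i j) := by
    intro i j h
    rw [funext (edgeIndicator_of_lt g h)]
    exact Measurable.ite (measurableSet_le (measurable_subtype_coe.comp (measurable_pi_apply _))
      (measurable_kernel_pi g.measurable_toFun _ _)) measurable_const measurable_const
  rcases lt_trichotomy i j with h | rfl | h
  · exact lt i j h
  · rw [funext (edgeIndicator_self g i)]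
    exact measurable_const
  · rw [funext (edgeIndicator_symm g i j)]
    exact lt j i h

/-- The edge indicator of `{i, j}` does not depend on the coordinate `a`, unless `a` is one of the
vertices `i` and `j` or the pair `{i, j}`. -/
theorem edgeIndicator_update (g : GraphFunction) (i j : Fin n) {a : SampleIndex n}
    (hi : a ≠ Sum.inl i) (hj : a ≠ Sum.inl j)
    (hq : ∀ q, a = Sum.inr q → q.1 ≠ (i, j) ∧ q.1 ≠ (j, i)) (x : SampleIndex n → I) (v : I) :
    edgeIndicator g i j (Function.update x a v) = edgeIndicator g i j x := by
  rcases lt_trichotomy i j with h | rfl | h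
  · rw [edgeIndicator_of_lt g h, edgeIndicator_of_lt g h, Function.update_of_ne hi.symm,
      Function.update_of_ne hj.symm, Function.update_of_ne]
    exact fun e => (hq _ e.symm).1 rfl
  · rw [edgeIndicator_self, edgeIndicator_self]
  · rw [edgeIndicator_symm, edgeIndicator_symm g i j, edgeIndicator_of_lt g h,
      edgeIndicator_of_lt g h, Function.update_of_ne hi.symm,
      Function.update_of_ne hj.symm, Function.update_of_ne]
    exact fun e => (hq _ e.symm).2 rfl

/-- Integrating out a leaf `i` attached to `j`. -/
theorem integral_edgeIndicator_mul {g : GraphFunction} {p : ℝ} (hp : ∀ᵐ y, g.degree y = p)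
    {i j : Fin n} (hij : i ≠ j) {R : (SampleIndex n → I) → ℝ} (hR : Measurable R)
    (hR1 : ∀ x, |R x| ≤ 1) (hRi : ∀ x v, R (Function.update x (Sum.inl i) v) = R x)
    (hRq : ∀ q : {q : Fin n × Fin n // q.1 < q.2}, q.1 = (i, j) ∨ q.1 = (j, i) →
      ∀ x v, R (Function.update x (Sum.inr q) v) = R x) :
    ∫ x, edgeIndicator g i j x * R x = p * ∫ x, R x := by
  have hne : (Sum.inl j : SampleIndex n) ≠ Sum.inl i := fun h => hij (Sum.inl_injective h).symm
  rcases lt_or_gt_of_ne hij with h | h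
  · simp_rw [edgeIndicator_of_lt g h]
    exact integral_threshold_kernel_mul hne Sum.inl_ne_inr Sum.inl_ne_inr g.measurable_toFun
      g.nonneg g.le_one hp hR hR1 hRi (hRq _ (Or.inl rfl))
  · simp_rw [edgeIndicator_symm g i j, edgeIndicator_of_lt g h]
    refine integral_threshold_kernel_mul (W := fun x y => g.toFun y x) hne Sum.inl_ne_inr
      Sum.inl_ne_inr g.measurable_swap (fun x y => g.nonneg y x) (fun x y => g.le_one y x) ?_
      hR hR1 hRi (hRq _ (Or.inr rfl))
    -- For `i > j` the leaf is the second argument of `g`, so the integral over it is the degree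
    -- only almost everywhere.
    filter_upwards [hp, g.ae_integral_right_eq_degree] with y h1 h2
    rw [h2, h1]

theorem measurable_prod_edgeIndicator (g : GraphFunction) (f : Fin n → Fin n)
    (S : Finset (Fin n)) : Measurable (fun x => ∏ i ∈ S, edgeIndicator g i (f i) x) :=
  Finset.measurable_prod _ fun i _ => measurable_edgeIndicator g i (f i)

theorem abs_prod_edgeIndicator_le_one (g : GraphFunction) (f : Fin n → Fin n)
    (S : Finset (Fin n)) (x : SampleIndex n → I) : |∏ i ∈ S, edgeIndicator g i (f i) x| ≤ 1 := by
  rw [Finset.abs_prod]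
  exact Finset.prod_le_one (fun _ _ => abs_nonneg _) fun i _ => abs_edgeIndicator_le_one g i _ x

/-- In a W-random graph with constant degrees `p`, a forest with edges `{i, f i}`, `i ∈ S`, is
present with probability `p ^ |S|`. -/
theorem integral_prod_edgeIndicator {g : GraphFunction} {p : ℝ} (hp : ∀ᵐ y, g.degree y = p)
    {f : Fin n → Fin n} (hf : IsForestMap f) (S : Finset (Fin n)) (hS : ∀ i ∈ S, f i ≠ i) :
    ∫ x, ∏ i ∈ S, edgeIndicator g i (f i) x = p ^ S.card := by
  induction S using Finset.strongInduction with
  | H S ih =>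
    rcases S.eq_empty_or_nonempty with rfl | hne
    · simp
    -- Since `S` is not contained in its image, some `i` in `S` is hit by no other vertex of `S`: it
    -- is a leaf whose only edge is `{i, f i}`.
    obtain ⟨i, hi, hif⟩ := Finset.not_subset.1 (hf S hne hS)
    have hleaf : ∀ j ∈ S.erase i, j ≠ i ∧ f j ≠ i := fun j hj =>
      ⟨Finset.ne_of_mem_erase hj,
        fun h => hif (Finset.mem_image.2 ⟨j, Finset.mem_of_mem_erase hj, h⟩)⟩
    simp_rw [← Finset.mul_prod_erase S _ hi]
    rw [integral_edgeIndicator_mul hp (hS i hi).symm (measurable_prod_edgeIndicator g f _)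
      (abs_prod_edgeIndicator_le_one g f _),
      ih _ (Finset.erase_ssubset hi) fun j hj => hS j (Finset.mem_of_mem_erase hj), ← pow_succ',
      Finset.card_erase_add_one hi]
    -- The other edges avoid the vertex `i`, hence do not depend on its variable.
    · refine fun x v => Finset.prod_congr rfl fun j hj => edgeIndicator_update g j (f j) ?_ ?_ ?_ x v
      · exact fun h => (hleaf j hj).1 (Sum.inl_injective h).symm
      · exact fun h => (hleaf j hj).2 (Sum.inl_injective h).symm
      · exact fun q h => absurd h Sum.inl_ne_inr
    -- Nor do they use the threshold of `{i, f i}`, since no other pair `{j, f j}` contains `i`.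
    · refine fun q hq x v => Finset.prod_congr rfl fun j hj =>
        edgeIndicator_update g j (f j) Sum.inr_ne_inl Sum.inr_ne_inl ?_ x v
      intro q' h
      obtain rfl := Sum.inr_injective h
      obtain ⟨h1, h2⟩ := hleaf j hj
      rcases hq with hq | hq <;> rw [hq] <;> simp [Ne.symm h1, Ne.symm h2]

/-! ### The expected determinant -/

theorem modifiedLaplacianDet_wRandomGraph (g : GraphFunction) (x : SampleIndex n → I) (p : ℝ)
    (ε : Fin n → ℝ) (z : ℂ) :
    modifiedLaplacianDet (wRandomGraph g x) p ε z
      = (weightedLaplacian (fun i => (1 + ε i * z) + p * z)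
          (fun i j => -(z / n) * (edgeIndicator g i j x : ℂ))).det := by
  classical
  have h : ∀ i j, (edgeIndicator g i j x : ℂ) = if (wRandomGraph g x).Adj i j then 1 else 0 := by
    intro i j
    rw [edgeIndicator]
    split_ifs <;> simp
  simp_rw [modifiedLaplacian_eq_weightedLaplacian, h]

theorem integrable_prod_edgeIndicator (g : GraphFunction) (f : Fin n → Fin n)
    (S : Finset (Fin n)) : Integrable (fun x => ((∏ i ∈ S, edgeIndicator g i (f i) x : ℝ) : ℂ)) :=
  (Integrable.of_bound (measurable_prod_edgeIndicator g f S).aestronglyMeasurable 1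
    (Filter.Eventually.of_forall (abs_prod_edgeIndicator_le_one g f S))).ofReal

/-- Isolates the randomness: in each term only the last factor depends on `x`. It is bounded by 1 in
absolute value, which yields integrability and lets the expectation be taken term by term. -/
theorem det_weightedLaplacian_edgeIndicator (g : GraphFunction) (c : Fin n → ℂ) (t : ℂ)
    (x : SampleIndex n → I) :
    (weightedLaplacian c (fun i j => t * (edgeIndicator g i j x : ℂ))).det
      = ∑ f : Fin n → Fin n, (∏ i ∈ Finset.univ.filter (fun i => f i = i), c i) *
          t ^ (Finset.univ.filter fun i => f i ≠ i).card * (functionalLaplacian ℂ f).det *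
          ((∏ i ∈ Finset.univ.filter (fun i => f i ≠ i), edgeIndicator g i (f i) x : ℝ) : ℂ) := by
  rw [det_weightedLaplacian]
  refine Finset.sum_congr rfl fun f _ => ?_
  rw [Finset.prod_mul_distrib, Finset.prod_const]
  push_cast
  ring

theorem integrable_det_weightedLaplacian (g : GraphFunction) (c : Fin n → ℂ) (t : ℂ) :
    Integrable (fun x : SampleIndex n → I =>
      (weightedLaplacian c (fun i j => t * (edgeIndicator g i j x : ℂ))).det) := by
  simp_rw [det_weightedLaplacian_edgeIndicator]
  exact integrable_finsetSum _ fun f _ => (integrable_prod_edgeIndicator g f _).const_mul _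

/-- The expected determinant only depends on the forest densities: the edge indicators may be
replaced by their common mean `p`. -/
theorem integral_det_weightedLaplacian {g : GraphFunction} {p : ℝ}
    (hp : ∀ᵐ y, g.degree y = p) (c : Fin n → ℂ) (t : ℂ) :
    ∫ x : SampleIndex n → I,
      (weightedLaplacian c (fun i j => t * (edgeIndicator g i j x : ℂ))).det
      = (weightedLaplacian c (fun _ _ => t * p)).det := by
  simp_rw [det_weightedLaplacian_edgeIndicator]
  rw [integral_finsetSum _ fun f _ => (integrable_prod_edgeIndicator g f _).const_mul _,
    det_weightedLaplacian]
  refine Finset.sum_congr rfl fun f _ => ?_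
  rw [integral_const_mul, integral_complex_ofReal, Finset.prod_const]
  -- The constant weights `t * p` were expanded over the same maps, so terms are compared one by
  -- one: forests by their density, the others because both sides vanish.
  by_cases hf : IsForestMap f
  · rw [integral_prod_edgeIndicator hp hf _ fun i hi => (Finset.mem_filter.1 hi).2]
    push_cast
    ring
  · rw [det_functionalLaplacian_eq_zero hf]
    ring

/-- Independence makes the joint law the product of the uniform marginals, so expectations over `Ω`
become integrals over the cube. -/
theorem IsUniformSample.measurePreserving {Ω : Type*} [MeasurableSpace Ω] {P : Measure Ω}
    [IsProbabilityMeasure P] {ξ : SampleIndex n → Ω → I} (hξ : IsUniformSample P ξ) :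
    MeasurePreserving (fun ω a => ξ a ω) P volume := by
  refine ⟨measurable_pi_iff.2 hξ.measurable, ?_⟩
  rw [(iIndepFun_iff_map_fun_eq_pi_map fun a => (hξ.measurable a).aemeasurable).1 hξ.indep]
  simp_rw [hξ.uniform]
  rfl

end RandomGraph

end

theorem mainTheorem8 (γ : Graphon) (hγ : γ.IsSingular) (p : ℝ) (hp : γ.edgeDensity = p)
    (g : GraphFunction) (hg : Graphon.mk g = γ)
    {Ω : Type*} [MeasurableSpace Ω] (P : Measure Ω) [IsProbabilityMeasure P]
    (n : ℕ) (hn : 1 ≤ n) (ξ : SampleIndex n → Ω → I) (hξ : IsUniformSample P ξ)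
    (ε : Fin n → ℝ) (z : ℂ) :
    Integrable (fun ω => modifiedLaplacianDet (wRandomGraph g (fun a => ξ a ω)) p ε z) P ∧
    (∫ ω, modifiedLaplacianDet (wRandomGraph g (fun a => ξ a ω)) p ε z ∂P
      = (1 / (n : ℂ)) * ∑ i, (1 + p * z + ε i * z) *
          ∏ j ∈ Finset.univ.erase i, (1 + ε j * z)) ∧
    ((∀ i, 1 + (ε i : ℂ) * z ≠ 0) →
      ∫ ω, modifiedLaplacianDet (wRandomGraph g (fun a => ξ a ω)) p ε z ∂P
        = (∏ i, (1 + ε i * z)) *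
          ((1 / (n : ℂ)) * ∑ i, (1 + p * z + ε i * z) / (1 + ε i * z))) := by
  have hdeg := hγ.ae_degree_eq hp hg
  have mp := hξ.measurePreserving
  simp_rw [modifiedLaplacianDet_wRandomGraph]
  have hint := integrable_det_weightedLaplacian g (fun i => (1 + ε i * z) + p * z) (-(z / n))
  have hE : ∫ ω, (weightedLaplacian (fun i => (1 + ε i * z) + p * z)
        (fun i j => -(z / n) * (edgeIndicator g i j (fun a => ξ a ω) : ℂ))).det ∂P
      = (1 / (n : ℂ)) * ∑ i, (1 + p * z + ε i * z) *
          ∏ j ∈ Finset.univ.erase i, (1 + ε j * z) := by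
    have h := integral_map mp.measurable.aemeasurable (μ := P)
      (by rw [mp.map_eq]; exact hint.aestronglyMeasurable)
    rw [mp.map_eq] at h
    -- The averaged weight is `-(p * z / n)`, so the constant-weight formula applies with `a i = 1 +
    -- ε i * z` and `t = p * z`.
    rw [← h, integral_det_weightedLaplacian hdeg,
      show -(z / (n : ℂ)) * p = -(p * z / n) by ring,
      det_weightedLaplacian_const hn (fun i => 1 + ε i * z) (p * z)]
    congr 1
    exact Finset.sum_congr rfl fun i _ => by ring
  refine ⟨mp.integrable_comp_of_integrable hint, hE, fun hne => hE.trans ?_⟩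
  rw [mul_left_comm, Finset.mul_sum (a := ∏ i, (1 + (ε i : ℂ) * z))]
  congr 1
  refine Finset.sum_congr rfl fun i _ => ?_
  rw [← Finset.mul_prod_erase Finset.univ (fun i => 1 + (ε i : ℂ) * z) (Finset.mem_univ i)]
  have cancel : ∀ b x a : ℂ, b ≠ 0 → x * a = b * a * (x / b) := fun b x a hb => by field_simp
  exact cancel _ _ _ (hne i)
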